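/- Let $X$ be a reflexive real Banach space with topological dual $X^*$, let $\langle x,v\rangle=v(x)$ for $x\in X$, $v\in X^*$, and give $X\times X^*$ the product norm topology. A multivalued operator $X\rightrightarrows X^*$ is identified with its graph. A set $T\subseteq X\times X^*$ is a monotone operator if $\langle x_1-x_2,v_1-v_2\rangle\ge 0$ for all $(x_1,v_1),(x_2,v_2)\in T$; it is maximal monotone if, in addition, it is not properly contained in any other monotone $T'\subseteq X\times X^*$. For such a $T$, let $\mathcal H(T)$ be the set of all convex lower semicontinuous functions $g:X\times X^*\to[-\infty,+\infty]$ with $g(x,v)\ge\langle x,v\rangle$ for all $(x,v)\in X\times X^*$ and $g(x,v)=\langle x,v\rangle$ for all $(x,v)\in T$. (An extended-real-valued function is convex if its epigraph is convex.) For $h:X\times X^*\to[-\infty,+\infty]$ let $$h^*(v,x)=\sup\{\langle y,v\rangle+\langle x,u\rangle-h(y,u)\;:\;(y,u)\in X\times X^*\}\qquad(x\in X,\ v\in X^*)$$ be its convex conjugate (with $X$ embedded canonically in $X^{**}$), and let $\mathcal J(h):X\times X^*\to[-\infty,+\infty]$, $\mathcal J(h)(x,v)=h^*(v,x)$. **Theorem.**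 Let $h:X\times X^*\to[-\infty,+\infty]$ be a convex lower semicontinuous function such that $$h(x,v)\ge\langle x,v\rangle\quad\text{and}\quad h^*(v,x)\ge\langle x,v\rangle\qquad\text{for all }(x,v)\in X\times X^*.$$ Define $T=\{(x,v)\in X\times X^*: h(x,v)=\langle x,v\rangle\}$. Then $T$ is a maximal monotone operator, and both $h$ and $\mathcal J(h)$ belong to $\mathcal H(T)$. -/

import Mathlib

noncomputable section

namespace FitzpatrickFamily

/-- A real normed space is reflexive if the canonical embedding into its bidual is onto. -/
def IsReflexiveSpace (X : Type*) [NormedAddCommGroup X] [NormedSpace ℝ X] : Prop :=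
  Function.Surjective (NormedSpace.inclusionInDoubleDual ℝ X)

/-- Convexity of an extended-real-valued function: its epigraph is a convex set. -/
def IsConvexFun {E : Type*} [AddCommGroup E] [Module ℝ E] (f : E → EReal) : Prop :=
  Convex ℝ {p : E × ℝ | f p.1 ≤ (p.2 : EReal)}

/-- The conjugate `f* (φ) = sup_x (⟨x, φ⟩ - f x)`, a function on the topological dual.
The subtrahend is the only term that can be infinite, so no `∞ - ∞` occurs. -/
def conjugate {E : Type*} [NormedAddCommGroup E] [NormedSpace ℝ E] (f : E → EReal) :
    StrongDual ℝ E → EReal :=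
  fun φ => ⨆ x : E, ((φ x : ℝ) : EReal) - f x

variable {X : Type*} [NormedAddCommGroup X] [NormedSpace ℝ X]

/-- The functional `(y, u) ↦ ⟨y, v⟩ + ⟨x, u⟩` on `X × X*`, that is, the element `(v, x)` of
`X* × X**` (with `x` embedded in `X**`), seen in the dual of `X × X*`. -/
def swapFunctional (x : X) (v : StrongDual ℝ X) : StrongDual ℝ (X × StrongDual ℝ X) :=
  v.coprod (NormedSpace.inclusionInDoubleDual ℝ X x)

/-- `𝒥(h)(x, v) = h*(v, x)`. -/
def conjSwap (h : X × StrongDual ℝ X → EReal) : X × StrongDual ℝ X → EReal :=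
  fun p => conjugate h (swapFunctional p.1 p.2)

theorem conjSwap_apply (h : X × StrongDual ℝ X → EReal) (x : X) (v : StrongDual ℝ X) :
    conjSwap h (x, v) =
      ⨆ q : X × StrongDual ℝ X, ((v q.1 + q.2 x : ℝ) : EReal) - h q :=
  rfl

/-- Monotone multivalued operators `X ⇉ X*`, identified with their graphs. -/
def IsMonotoneOp (T : Set (X × StrongDual ℝ X)) : Prop :=
  ∀ p ∈ T, ∀ q ∈ T, 0 ≤ (p.2 - q.2) (p.1 - q.1)

/-- A monotone operator whose graph is not properly contained in that of another one. -/
def IsMaximalMonotoneOp (T : Set (X × StrongDual ℝ X)) : Prop :=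
  IsMonotoneOp T ∧ ∀ S : Set (X × StrongDual ℝ X), IsMonotoneOp S → ¬ T ⊂ S

/-- The Fitzpatrick family `ℋ(T)`: the convex lower semicontinuous functions
`h : X × X* → [-∞, ∞]` that majorize the duality product and coincide with it on `T`. -/
def family (T : Set (X × StrongDual ℝ X)) : Set (X × StrongDual ℝ X → EReal) :=
  {h | IsConvexFun h ∧ LowerSemicontinuous h ∧
    (∀ (x : X) (v : StrongDual ℝ X), ((v x : ℝ) : EReal) ≤ h (x, v)) ∧
    ∀ (x : X) (v : StrongDual ℝ X), (x, v) ∈ T → h (x, v) = ((v x : ℝ) : EReal)}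

end FitzpatrickFamily

end

open Set

namespace FitzpatrickFamily

/-! ### Conjugates, Fenchel–Moreau, sandwich separation and the half squared norm. -/

section Conjugation

variable {E : Type*} [NormedAddCommGroup E] [NormedSpace ℝ E]

/-! Maximality comes from a surjectivity property: each `(x₀, v₀)` admits `(x, v) ∈ T` with `‖x -
x₀‖²/2 + ‖v - v₀‖²/2 ≤ -⟨x - x₀, v - v₀⟩` (`exists_mem_and_norm_sq_add_le`). If `(x₀, v₀)` is
monotonically related to `T`, the right side is nonpositive and the two points coincide. To find
`(x, v)`, subtract both half squares from the first-order expansion of the pairing at `(x₀, v₀)`.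
The result is a continuous concave function below the pairing, hence below `𝒥(h)`. An affine
function fits in between (`exists_affine_between`); by reflexivity its slope is some `(x, v)`, and
Fenchel–Moreau bounds `h (x, v)` by minus its constant term. Monotonicity of `T` is convexity at
midpoints; `𝒥(h)` agrees with the pairing on `T` by a derivative argument (`conjSwap_le_of_eq`). -/

theorem IsConvexFun.le_coe {f : E → EReal} (hf : IsConvexFun f) {p q : E} {a b s t : ℝ}
    (hp : f p ≤ a) (hq : f q ≤ b) (hs : 0 ≤ s) (ht : 0 ≤ t) (hst : s + t = 1) :
    f (s • p + t • q) ≤ ((s * a + t * b : ℝ) : EReal) :=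
  hf (x := (p, a)) hp (y := (q, b)) hq hs ht hst

/-- Testing against real points of the epigraph keeps later arguments free of infinite values. -/
theorem conjugate_le_coe_iff {f : E → EReal} {φ : StrongDual ℝ E} {c : ℝ} :
    conjugate f φ ≤ c ↔ ∀ (x : E) (r : ℝ), f x ≤ r → φ x - r ≤ c := by
  unfold conjugate
  rw [iSup_le_iff]
  refine forall_congr' fun x => ?_
  generalize f x = y
  induction y with
  | bot =>
    simp only [EReal.coe_sub_bot, top_le_iff, EReal.coe_ne_top, bot_le, forall_const, false_iff,
      not_forall, not_le]
    exact ⟨φ x - c - 1, by linarith⟩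
  | top => simp
  | coe y =>
    norm_cast
    exact ⟨fun h r hr => by linarith, fun h => h y le_rfl⟩

theorem isConvexFun_conjugate (f : E → EReal) : IsConvexFun (conjugate f) := by
  rintro ⟨φ, a⟩ hφ ⟨ψ, b⟩ hψ s t hs ht hst
  simp only [mem_ofPred, conjugate_le_coe_iff] at hφ hψ
  show conjugate f (s • φ + t • ψ) ≤ ((s * a + t * b : ℝ) : EReal)
  rw [conjugate_le_coe_iff]
  intro x r hr
  have h1 := mul_le_mul_of_nonneg_left (hφ x r hr) hs
  have h2 := mul_le_mul_of_nonneg_left (hψ x r hr) ht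
  have h3 : s * r + t * r = r := by rw [← add_mul, hst, one_mul]
  simp only [add_apply, smul_apply, smul_eq_mul]
  linarith

theorem lowerSemicontinuous_conjugate (f : E → EReal) :
    LowerSemicontinuous (conjugate f) := by
  refine lowerSemicontinuous_iSup fun x => ?_
  generalize f x = y
  induction y with
  | bot => simpa using lowerSemicontinuous_const
  | top => simpa using lowerSemicontinuous_const
  | coe y =>
    refine Continuous.lowerSemicontinuous ?_
    have : Continuous fun φ : StrongDual ℝ E => ((φ x - y : ℝ) : EReal) :=
      continuous_coe_real_ereal.comp (by fun_prop)
    simpa using this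

theorem isClosed_real_epigraph {E : Type*} [TopologicalSpace E] {f : E → EReal} (hf : LowerSemicontinuous f) :
    IsClosed {p : E × ℝ | f p.1 ≤ (p.2 : EReal)} :=
  hf.isClosed_epigraph.preimage
    (continuous_fst.prodMk (continuous_coe_real_ereal.comp continuous_snd))

theorem dual_prod_real_apply (F : StrongDual ℝ (E × ℝ)) (z : E) (r : ℝ) :
    F (z, r) = F.comp (.inl ℝ E ℝ) z + F (0, 1) * r := by
  have : ((z, r) : E × ℝ) = (z, 0) + r • (0, 1) := by simp
  rw [this, map_add, map_smul, smul_eq_mul, mul_comm]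
  rfl

/-- Strict separation of a point below the graph of a closed convex function from the epigraph. -/
theorem exists_separation_epigraph {f : E → EReal} (hc : IsConvexFun f)
    (hl : LowerSemicontinuous f) {p : E} {α : ℝ} (hp : ¬ f p ≤ α) :
    ∃ (ψ : StrongDual ℝ E) (s u : ℝ), ψ p + s * α < u ∧
      ∀ (q : E) (r : ℝ), f q ≤ r → u < ψ q + s * r := by
  obtain ⟨F, u, h1, h2⟩ := geometric_hahn_banach_point_closed (x := (p, α)) hc
    (isClosed_real_epigraph hl) hp
  refine ⟨F.comp (.inl ℝ E ℝ), F (0, 1), u, ?_, fun q r hq => ?_⟩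
  · rwa [← dual_prod_real_apply]
  · rw [← dual_prod_real_apply]
    exact h2 (q, r) hq

theorem conjugate_neg_smul_le {f : E → EReal} {ψ : StrongDual ℝ E} {s u : ℝ} (hs : 0 < s)
    (h : ∀ (q : E) (r : ℝ), f q ≤ r → u ≤ ψ q + s * r) :
    conjugate f (-(s⁻¹ • ψ)) ≤ ((-(s⁻¹ * u) : ℝ) : EReal) := by
  rw [conjugate_le_coe_iff]
  intro q r hq
  have h1 := mul_le_mul_of_nonneg_left (h q r hq) (inv_pos.2 hs).le
  rw [mul_add, inv_mul_cancel_left₀ hs.ne'] at h1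
  simp only [neg_apply, smul_apply, smul_eq_mul]
  linarith

theorem exists_conjugate_le_coe {f : E → EReal} (hc : IsConvexFun f)
    (hl : LowerSemicontinuous f) {q : E} {a : ℝ} (hq : f q = a) :
    ∃ (φ : StrongDual ℝ E) (c : ℝ), conjugate f φ ≤ c := by
  -- A hyperplane separating `(q, a - 1)` from `(q, a)`, directly above it, cannot be vertical.
  have hlt : ¬ f q ≤ ((a - 1 : ℝ) : EReal) := by
    rw [hq, EReal.coe_le_coe_iff]
    linarith
  obtain ⟨ψ, s, u, h1, h2⟩ := exists_separation_epigraph hc hl hlt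
  have h3 := h2 q a hq.le
  exact ⟨_, _, conjugate_neg_smul_le (by linarith) fun q r hr => (h2 q r hr).le⟩

/-- The Fenchel–Moreau inequality `f ≤ f**` for a proper closed convex function. -/
theorem le_coe_of_forall_conjugate {f : E → EReal} (hc : IsConvexFun f)
    (hl : LowerSemicontinuous f) {q : E} {a : ℝ} (hq : f q = a) {p : E} {α : ℝ}
    (hα : ∀ (φ : StrongDual ℝ E) (c : ℝ), conjugate f φ ≤ c → φ p - α ≤ c) :
    f p ≤ α := by
  by_contra hp
  obtain ⟨ψ, s, u, h1, h2⟩ := exists_separation_epigraph hc hl hp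
  have hs : 0 ≤ s := by
    by_contra! hs
    set r : ℝ := max a ((u - ψ q) / s)
    have h3 := h2 q r (by rw [hq]; exact_mod_cast le_max_left _ _)
    have h4 : s * r ≤ u - ψ q := by
      rw [← div_le_iff_of_neg' hs]
      exact le_max_right _ _
    linarith
  rcases hs.eq_or_lt with rfl | hs
  -- Vertical hyperplane: tilting a fixed affine minorant by `-t • ψ` gives minorants whose values
  -- at `p` are unbounded as `t` grows.
  · obtain ⟨φ, c, hφ⟩ := exists_conjugate_le_coe hc hl hq
    rw [conjugate_le_coe_iff] at hφ
    have key : ∀ t : ℝ, 0 ≤ t → t * (u - ψ p) ≤ c - (φ p - α) := by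
      intro t ht
      have h3 : conjugate f (φ - t • ψ) ≤ ((c - t * u : ℝ) : EReal) := by
        rw [conjugate_le_coe_iff]
        intro x r hr
        have h4 := hφ x r hr
        have h5 := mul_le_mul_of_nonneg_left (h2 x r hr).le ht
        simp only [sub_apply, smul_apply, smul_eq_mul]
        linarith
      have h6 := hα _ _ h3
      simp only [sub_apply, smul_apply, smul_eq_mul] at h6
      linarith
    have hd : 0 < u - ψ p := by linarith
    have h0 := key 0 le_rfl
    have h7 := key ((c - (φ p - α) + 1) / (u - ψ p)) (div_nonneg (by linarith) hd.le)
    rw [div_mul_cancel₀ _ hd.ne'] at h7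
    linarith
  · have h3 := hα _ _ (conjugate_neg_smul_le hs fun q r hr => (h2 q r hr).le)
    have h4 := mul_lt_mul_of_pos_left h1 (inv_pos.2 hs)
    rw [mul_add, inv_mul_cancel_left₀ hs.ne'] at h4
    simp only [neg_apply, smul_apply, smul_eq_mul] at h3
    linarith

/-- A continuous affine function can be inserted between a continuous concave function and a
convex function above it. -/
theorem exists_affine_between {f : E → EReal} (hc : IsConvexFun f) {g : E → ℝ}
    (hg : ConcaveOn ℝ univ g) (hgc : Continuous g) (hgf : ∀ z, (g z : EReal) ≤ f z)
    {q : E} {a : ℝ} (hq : f q ≤ a) :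
    ∃ (φ : StrongDual ℝ E) (α : ℝ), conjugate f φ ≤ α ∧ ∀ z, g z ≤ φ z - α := by
  have ho : IsOpen {p : E × ℝ | p.1 ∈ univ ∧ p.2 < g p.1} := by
    simpa using isOpen_lt continuous_snd (hgc.comp continuous_fst)
  obtain ⟨F, u, h1, h2⟩ := geometric_hahn_banach_open hg.convex_strict_hypograph ho hc <| by
    rw [Set.disjoint_left]
    rintro ⟨z, r⟩ ⟨-, hr⟩ hr'
    exact absurd ((hgf z).trans hr') (not_le.2 (by exact_mod_cast hr))
  set ψ := F.comp (.inl ℝ E ℝ)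
  set s := F (0, 1)
  replace h1 : ∀ z r, r < g z → ψ z + s * r < u := fun z r hr => by
    rw [← dual_prod_real_apply]
    exact h1 (z, r) ⟨mem_univ _, hr⟩
  replace h2 : ∀ z (r : ℝ), f z ≤ r → u ≤ ψ z + s * r := fun z r hr => by
    rw [← dual_prod_real_apply]
    exact h2 (z, r) hr
  -- Hypograph and epigraph both have points over `q`, which rules out a vertical hyperplane.
  have hs : 0 < s := by
    have h3 := h1 q (g q - 1) (by linarith)
    have h4 := h2 q a hq
    have h5 : g q ≤ a := by exact_mod_cast (hgf q).trans hq
    by_contra! hs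
    nlinarith
  refine ⟨_, _, conjugate_neg_smul_le hs h2, fun z => ?_⟩
  refine le_of_forall_lt fun r hr => ?_
  have h3 := mul_lt_mul_of_pos_left (h1 z r hr) (inv_pos.2 hs)
  rw [mul_add, inv_mul_cancel_left₀ hs.ne'] at h3
  simp only [neg_apply, smul_apply, smul_eq_mul]
  linarith

/-- Half the squared norm is conjugate to half the squared dual norm. On each line through `0` the
hypothesis is a nonnegative quadratic, so its discriminant is nonpositive. -/
theorem norm_sq_le_of_forall_apply_le {φ : StrongDual ℝ E} {β : ℝ}
    (h : ∀ y, φ y ≤ ‖y‖ ^ 2 / 2 + β) : ‖φ‖ ^ 2 / 2 ≤ β := by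
  have h0 : 0 ≤ β := by simpa using h 0
  have h1 : ‖φ‖ ≤ √(2 * β) := by
    refine φ.opNorm_le_bound (Real.sqrt_nonneg _) fun y => ?_
    have h2 : discrim (‖y‖ ^ 2 / 2) (-φ y) β ≤ 0 := discrim_le_zero fun t => by
      have h3 := h (t • y)
      rw [map_smul, smul_eq_mul, norm_smul, mul_pow, Real.norm_eq_abs, sq_abs] at h3
      linarith
    rw [discrim] at h2
    rw [Real.norm_eq_abs]
    refine abs_le_of_sq_le_sq ?_ (by positivity)
    rw [mul_pow, Real.sq_sqrt (by positivity)]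
    linarith
  have h2 := pow_le_pow_left₀ (norm_nonneg φ) h1 2
  rw [Real.sq_sqrt (by positivity)] at h2
  linarith

theorem concaveOn_neg_norm_sub_sq (z : E) :
    ConcaveOn ℝ univ fun y : E => -(‖y - z‖ ^ 2 / 2) := by
  have h := (convexOn_univ_dist z).pow (fun _ _ => dist_nonneg) 2
  have h' := (h.smul (c := (1 / 2 : ℝ)) (by norm_num)).neg
  refine h'.congr fun y _ => ?_
  simp [dist_eq_norm]
  ring

theorem exists_dual_vector_sq (x : E) : ∃ u : StrongDual ℝ E, ‖u‖ ≤ ‖x‖ ∧ u x = ‖x‖ ^ 2 := by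
  obtain ⟨g, hg, hgx⟩ := exists_dual_vector'' ℝ x
  refine ⟨‖x‖ • g, ?_, ?_⟩
  · rw [norm_smul, norm_norm]
    exact mul_le_of_le_one_right (norm_nonneg _) hg
  · simp [hgx, sq]

end Conjugation

/-! ### The pairing on `X × X*` and the set where `h` equals it. -/

section DualityProduct

variable {X : Type*} [NormedAddCommGroup X] [NormedSpace ℝ X]

theorem swapFunctional_apply (x : X) (v : StrongDual ℝ X) (q : X × StrongDual ℝ X) :
    swapFunctional x v q = v q.1 + q.2 x := rfl

theorem IsReflexiveSpace.exists_eq_swapFunctional (hX : IsReflexiveSpace X)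
    (φ : StrongDual ℝ (X × StrongDual ℝ X)) : ∃ x v, φ = swapFunctional x v := by
  obtain ⟨x, hx⟩ := hX (φ.comp (.inr ℝ X (StrongDual ℝ X)))
  refine ⟨x, φ.comp (.inl ℝ X (StrongDual ℝ X)), ?_⟩
  rw [swapFunctional, hx]
  ext <;> simp

theorem isConvexFun_conjSwap (h : X × StrongDual ℝ X → EReal) : IsConvexFun (conjSwap h) := by
  rintro ⟨p, a⟩ hp ⟨q, b⟩ hq s t hs ht hst
  have h1 := (isConvexFun_conjugate h).le_coe hp hq hs ht hst
  have h2 : s • swapFunctional p.1 p.2 + t • swapFunctional q.1 q.2 =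
      swapFunctional (s • p + t • q).1 (s • p + t • q).2 := by
    ext z <;> simp [swapFunctional]
  rwa [h2] at h1

theorem continuous_swapFunctional :
    Continuous fun p : X × StrongDual ℝ X => swapFunctional p.1 p.2 := by
  have h : (fun p : X × StrongDual ℝ X => swapFunctional p.1 p.2) = fun p =>
      p.2.comp (.fst ℝ X (StrongDual ℝ X)) +
        (NormedSpace.inclusionInDoubleDual ℝ X p.1).comp (.snd ℝ X (StrongDual ℝ X)) := by
    ext p z <;> simp [swapFunctional]
  rw [h]
  exact (continuous_snd.clm_comp continuous_const).add
    (((NormedSpace.inclusionInDoubleDual ℝ X).continuous.comp continuous_fst).clm_comp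
      continuous_const)

theorem lowerSemicontinuous_conjSwap (h : X × StrongDual ℝ X → EReal) :
    LowerSemicontinuous (conjSwap h) :=
  (lowerSemicontinuous_conjugate h).comp continuous_swapFunctional

variable {h : X × StrongDual ℝ X → EReal}

theorem isMonotoneOp_of_le (hc : IsConvexFun h)
    (hge : ∀ (x : X) (v : StrongDual ℝ X), ((v x : ℝ) : EReal) ≤ h (x, v)) :
    IsMonotoneOp {p : X × StrongDual ℝ X | h p = ((p.2 p.1 : ℝ) : EReal)} := by
  rintro p hp q hq
  have h1 := hc.le_coe (s := 1 / 2) (t := 1 / 2) (le_of_eq hp) (le_of_eq hq) (by norm_num)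
    (by norm_num) (by norm_num)
  have h2 := (hge _ _).trans h1
  rw [EReal.coe_le_coe_iff] at h2
  simp only [add_apply, smul_apply, map_add, map_smul, smul_eq_mul,
    Prod.smul_fst, Prod.smul_snd, sub_apply, map_sub] at h2 ⊢
  linarith

/-- On the segment from `p` to `q`, convexity bounds `h` above and the pairing bounds it below, with
equality at `p`. Dividing by `t` and letting `t → 0` compares slopes at `p`. -/
theorem conjSwap_le_of_eq (hc : IsConvexFun h)
    (hge : ∀ (x : X) (v : StrongDual ℝ X), ((v x : ℝ) : EReal) ≤ h (x, v))
    {p : X × StrongDual ℝ X} (hp : h p = ((p.2 p.1 : ℝ) : EReal)) :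
    conjSwap h p ≤ ((p.2 p.1 : ℝ) : EReal) := by
  rw [conjSwap, conjugate_le_coe_iff]
  intro q r hr
  rw [swapFunctional_apply]
  have key : ∀ t ∈ Ioo (0 : ℝ) 1, (1 - t) * (p.2 q.1 + q.2 p.1 - p.2 p.1) + t * q.2 q.1 ≤ r := by
    rintro t ⟨ht0, ht1⟩
    have h1 := hc.le_coe (s := 1 - t) (t := t) hp.le hr (by linarith) ht0.le (by ring)
    have h2 := (hge _ _).trans h1
    rw [EReal.coe_le_coe_iff] at h2
    simp only [add_apply, smul_apply, map_add, map_smul, smul_eq_mul,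
      Prod.smul_fst, Prod.smul_snd] at h2
    refine le_of_mul_le_mul_left ?_ ht0
    linarith
  have hlim : Filter.Tendsto
      (fun t : ℝ => (1 - t) * (p.2 q.1 + q.2 p.1 - p.2 p.1) + t * q.2 q.1)
      (nhdsWithin 0 (Ioi 0)) (nhds ((1 - 0) * (p.2 q.1 + q.2 p.1 - p.2 p.1) + 0 * q.2 q.1)) :=
    Continuous.tendsto' (by fun_prop) _ _ rfl |>.mono_left nhdsWithin_le_nhds
  have h3 := le_of_tendsto hlim (Filter.mem_of_superset (Ioo_mem_nhdsGT one_pos) key)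
  linarith

/-- Every point is the base of a solution of the inclusion `-(v - v₀) ∈ J (x - x₀)`, with `J` the
duality mapping, on the set where `h` is the duality product. -/
theorem exists_mem_and_norm_sq_add_le (hX : IsReflexiveSpace X) (hc : IsConvexFun h)
    (hl : LowerSemicontinuous h)
    (hge : ∀ (x : X) (v : StrongDual ℝ X), ((v x : ℝ) : EReal) ≤ h (x, v))
    (hge' : ∀ (x : X) (v : StrongDual ℝ X), ((v x : ℝ) : EReal) ≤ conjSwap h (x, v))
    (x₀ : X) (v₀ : StrongDual ℝ X) :
    ∃ (x : X) (v : StrongDual ℝ X), h (x, v) = ((v x : ℝ) : EReal) ∧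
      ‖x - x₀‖ ^ 2 / 2 + ‖v - v₀‖ ^ 2 / 2 ≤ -(v - v₀) (x - x₀) := by
  -- If `h` were identically `⊤`, its conjugate would be `⊥`, below the pairing.
  obtain ⟨q, a, hq⟩ : ∃ (q : X × StrongDual ℝ X) (a : ℝ), h q = a := by
    by_contra! hne
    have htop : ∀ q, h q = ⊤ := fun q => by
      by_contra hq
      exact hne q (h q).toReal (EReal.coe_toReal hq
        (ne_bot_of_le_ne_bot (EReal.coe_ne_bot _) (hge q.1 q.2))).symm
    have h1 : conjSwap h (0, 0) ≤ ((-1 : ℝ) : EReal) := by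
      rw [conjSwap, conjugate_le_coe_iff]
      intro x r hr
      simp [htop] at hr
    have h2 := (hge' 0 0).trans h1
    rw [EReal.coe_le_coe_iff] at h2
    norm_num at h2
  obtain ⟨φ, c, hφ⟩ := exists_conjugate_le_coe hc hl hq
  obtain ⟨y, u, rfl⟩ := hX.exists_eq_swapFunctional φ
  let g : X × StrongDual ℝ X → ℝ := fun z =>
    swapFunctional x₀ v₀ z + (-(‖z.1 - x₀‖ ^ 2 / 2) + -(‖z.2 - v₀‖ ^ 2 / 2)) + -(v₀ x₀)
  have hg : ConcaveOn ℝ univ g :=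
    (((swapFunctional x₀ v₀).toLinearMap.concaveOn convex_univ).add
      (((concaveOn_neg_norm_sub_sq x₀).comp_linearMap (.fst ℝ X (StrongDual ℝ X))).add
        ((concaveOn_neg_norm_sub_sq v₀).comp_linearMap (.snd ℝ X (StrongDual ℝ X))))).add_const _
  have hgc : Continuous g := by fun_prop
  have hgle : ∀ z, (g z : EReal) ≤ conjSwap h z := by
    refine fun z => le_trans ?_ (hge' z.1 z.2)
    rw [EReal.coe_le_coe_iff]
    have h1 := (abs_le.1 ((z.2 - v₀).le_opNorm (z.1 - x₀))).1
    simp only [sub_apply, map_sub] at h1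
    simp only [g, swapFunctional_apply]
    nlinarith [sq_nonneg (‖z.1 - x₀‖ - ‖z.2 - v₀‖)]
  obtain ⟨φ, α, h1, h2⟩ := exists_affine_between (isConvexFun_conjSwap h) hg hgc hgle
    (q := (y, u)) hφ
  obtain ⟨x, v, rfl⟩ := hX.exists_eq_swapFunctional φ
  rw [conjugate_le_coe_iff] at h1
  have h3 : h (x, v) ≤ α := by
    refine le_coe_of_forall_conjugate hc hl hq fun φ c hφ => ?_
    obtain ⟨y, u, rfl⟩ := hX.exists_eq_swapFunctional φ
    have h4 := h1 (y, u) c hφ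
    simp only [swapFunctional_apply] at h4 ⊢
    linarith
  have h4 : ‖v - v₀‖ ^ 2 / 2 ≤ v x₀ + v₀ x - v₀ x₀ - α - ‖x - x₀‖ ^ 2 / 2 := by
    refine norm_sq_le_of_forall_apply_le fun y => ?_
    -- Choosing `w` in the duality mapping at `x - x₀` yields the term `‖x - x₀‖²/2` exactly; `y`
    -- stays free to yield the dual norm.
    obtain ⟨w, hw, hwx⟩ := exists_dual_vector_sq (x - x₀)
    have h5 := h2 (x₀ - y, v₀ - w)
    have h6 := pow_le_pow_left₀ (norm_nonneg w) hw 2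
    simp only [g, swapFunctional_apply, sub_apply, map_sub, sub_sub_cancel_left, norm_neg]
      at h5 hwx ⊢
    linarith
  have h5 : v x ≤ α := by exact_mod_cast (hge x v).trans h3
  have h6 := (abs_le.1 ((v - v₀).le_opNorm (x - x₀))).1
  have h7 := sq_nonneg (‖x - x₀‖ - ‖v - v₀‖)
  simp only [sub_apply, map_sub] at h6
  -- Since `-⟨x - x₀, v - v₀⟩` is at most the sum of the half squares, `h4` also forces `α ≤ ⟨x,
  -- v⟩`.
  refine ⟨x, v, le_antisymm (h3.trans ?_) (hge x v), ?_⟩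
  · rw [EReal.coe_le_coe_iff]
    linarith
  · simp only [sub_apply, map_sub]
    linarith

end DualityProduct

end FitzpatrickFamily

theorem mainTheorem1 {X : Type*} [NormedAddCommGroup X] [NormedSpace ℝ X] [CompleteSpace X]
    (hX : FitzpatrickFamily.IsReflexiveSpace X)
    (h : X × StrongDual ℝ X → EReal)
    (h_convex : FitzpatrickFamily.IsConvexFun h)
    (h_lsc : LowerSemicontinuous h)
    (h_ge : ∀ (x : X) (v : StrongDual ℝ X), ((v x : ℝ) : EReal) ≤ h (x, v))
    (h_conj_ge : ∀ (x : X) (v : StrongDual ℝ X),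
      ((v x : ℝ) : EReal) ≤
        FitzpatrickFamily.conjugate h (FitzpatrickFamily.swapFunctional x v))
    (T : Set (X × StrongDual ℝ X))
    (hT : T = {p | h p = ((p.2 p.1 : ℝ) : EReal)}) :
    FitzpatrickFamily.IsMaximalMonotoneOp T ∧
      h ∈ FitzpatrickFamily.family T ∧
      FitzpatrickFamily.conjSwap h ∈ FitzpatrickFamily.family T := by
  have hge' : ∀ (x : X) (v : StrongDual ℝ X),
      ((v x : ℝ) : EReal) ≤ FitzpatrickFamily.conjSwap h (x, v) := h_conj_ge
  subst hT
  refine ⟨⟨FitzpatrickFamily.isMonotoneOp_of_le h_convex h_ge, fun S hS hTS => ?_⟩,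
    ⟨h_convex, h_lsc, h_ge, fun x v hxv => hxv⟩,
    ⟨FitzpatrickFamily.isConvexFun_conjSwap h, FitzpatrickFamily.lowerSemicontinuous_conjSwap h,
      hge', fun x v hxv => le_antisymm
        (FitzpatrickFamily.conjSwap_le_of_eq h_convex h_ge hxv) (hge' x v)⟩⟩
  obtain ⟨hsub, hnot⟩ := hTS
  refine hnot fun p hp => ?_
  obtain ⟨x, v, hxv, hle⟩ := FitzpatrickFamily.exists_mem_and_norm_sq_add_le hX h_convex h_lsc
    h_ge hge' p.1 p.2
  have hmono := hS (x, v) (hsub hxv) p hp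
  have hx : ‖x - p.1‖ = 0 := by
    refine pow_eq_zero_iff two_ne_zero |>.1 (le_antisymm ?_ (sq_nonneg _))
    linarith [sq_nonneg ‖v - p.2‖]
  have hv : ‖v - p.2‖ = 0 := by
    refine pow_eq_zero_iff two_ne_zero |>.1 (le_antisymm ?_ (sq_nonneg _))
    linarith [sq_nonneg ‖x - p.1‖]
  rw [norm_sub_eq_zero_iff] at hx hv
  subst hx hv
  exact hxv
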